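/- A hypergraph $G$ consists of a finite nonempty vertex set $V(G)$ and a set $E(G)$ of nonempty subsets of $V(G)$, called edges; it is $k$-uniform if every edge has exactly $k$ vertices. A walk of length $p$ from $u$ to $v$ is a sequence $(v_0,e_1,v_1,\dots,e_p,v_p)$ with $v_0=u$, $v_p=v$, where each $e_i$ is an edge containing $v_{i-1}$ and $v_i$, and $v_{i-1}\neq v_i$. A path is a walk with all $v_i$ distinct and all $e_i$ distinct (a single vertex is a path of length $0$). A cycle is a walk with at least two edges in which all $e_i$ are distinct and all $v_i$ are distinct except that $v_0=v_p$. A hypertree is a hypergraph without cycles in which any two vertices are joined by a path. The distance $d_G(u,v)$ is the length of a shortest path from $u$ to $v$, and the distance spectral radius $\rho(G)$ of a connected hypergraph $G$ is the largest eigenvalue of the real symmetric matrix $(d_G(u,v))_{u,v\in V(G)}$. Two hypergraphs are isomorphic ($\cong$) if there is a bijection between their vertex sets that induces a bijection between their edge sets. For $k\ge 2$ and $n-1=m(k-1)$ with an integer $m\ge 1$, the hyperstar $S_{n,k}$ is the hypergraph on $n$ vertices whose vertex set is a disjoint union $\{u\}\cup V_1\cup\dots\cup V_m$ with $|V_1|=\dots=|V_m|=k-1$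 and whose edges are the sets $\{u\}\cup V_i$, $1\le i\le m$. **Theorem 4.4.** Let $k\ge 2$ and let $T$ be a $k$-uniform hypertree on $n$ vertices, where $\frac{n-1}{k-1}\ge 1$. Then $n-1$ is a multiple of $k-1$, $S_{n,k}$ is itself a $k$-uniform hypertree on $n$ vertices, and $\rho(T)\ge\rho(S_{n,k})$, with equality if and only if $T\cong S_{n,k}$. -/

import Mathlib

namespace Hypergraph

universe u v

/-- Walks `(v₀, e₁, v₁, …, e_p, v_p)` in a hypergraph: each edge `e_i` contains `v_{i-1}` and `v_i`,
and `v_{i-1} ≠ v_i`. A single vertex is a walk of length `0`. -/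
inductive Walk {α : Type u} (G : Hypergraph α) : α → α → Type u
  | nil {a : α} (ha : a ∈ G.vertexSet) : Walk G a a
  | cons {a b c : α} (e : Set α) (he : e ∈ G.edgeSet) (ha : a ∈ e) (hb : b ∈ e) (hab : a ≠ b)
      (p : Walk G b c) : Walk G a c

namespace Walk

variable {α : Type u} {G : Hypergraph α}

/-- The number `p` of edges of the walk `(v₀, e₁, v₁, …, e_p, v_p)`. -/
def length : {a b : α} → G.Walk a b → ℕ
  | _, _, nil _ => 0
  | _, _, cons _ _ _ _ _ p => p.length + 1

/-- The list `[v₀, v₁, …, v_p]` of the vertices of a walk. -/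
def support : {a b : α} → G.Walk a b → List α
  | a, _, nil _ => [a]
  | a, _, cons _ _ _ _ _ p => a :: p.support

/-- The list `[e₁, …, e_p]` of the edges of a walk. -/
def edges : {a b : α} → G.Walk a b → List (Set α)
  | _, _, nil _ => []
  | _, _, cons e _ _ _ _ p => e :: p.edges

/-- A path is a walk with all vertices distinct and all edges distinct. -/
def IsPath {a b : α} (p : G.Walk a b) : Prop :=
  p.support.Nodup ∧ p.edges.Nodup

/-- A cycle is a closed walk with at least two edges, whose edges are all distinct, and whose
vertices are all distinct except that the first and the last one agree. -/
def IsCycle {a : α} (p : G.Walk a a) : Prop :=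
  2 ≤ p.length ∧ p.edges.Nodup ∧ p.support.tail.Nodup

end Walk

/-- Every edge has exactly `k` vertices (used for `k ≥ 2`). -/
def IsUniform {α : Type u} (G : Hypergraph α) (k : ℕ) : Prop :=
  ∀ e ∈ G.edgeSet, e.ncard = k

/-- There is at least one vertex, and any two vertices are joined by a path. -/
def IsConnected {α : Type u} (G : Hypergraph α) : Prop :=
  G.vertexSet.Nonempty ∧
    ∀ a ∈ G.vertexSet, ∀ b ∈ G.vertexSet, ∃ p : G.Walk a b, p.IsPath

/-- A hypertree is a connected hypergraph without cycles. -/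
def IsHypertree {α : Type u} (G : Hypergraph α) : Prop :=
  G.IsConnected ∧ ∀ (a : α) (p : G.Walk a a), ¬ p.IsCycle

/-- The distance between two vertices: the length of a shortest path. (It takes the value `0` when
there is no path at all, which does not happen in a connected hypergraph.) -/
noncomputable def dist {α : Type u} (G : Hypergraph α) (a b : α) : ℕ :=
  sInf {l : ℕ | ∃ p : G.Walk a b, p.IsPath ∧ p.length = l}

/-- The distance matrix, with rows and columns indexed by the vertices. -/
noncomputable def distMatrix {α : Type u} (G : Hypergraph α) :
    Matrix G.vertexSet G.vertexSet ℝ :=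
  Matrix.of fun a b => (G.dist a b : ℝ)

/-- The distance spectral radius: the largest (real) eigenvalue of the distance matrix. For a
finite hypergraph with at least one vertex the set of eigenvalues of this real symmetric matrix is
finite and nonempty, so that the supremum is a maximum. -/
noncomputable def distSpectralRadius {α : Type u} (G : Hypergraph α) [Fintype G.vertexSet] : ℝ :=
  sSup {μ : ℝ | Module.End.HasEigenvalue G.distMatrix.mulVecLin μ}

/-- `G ≅ H`: a bijection between the vertex sets under which the edges of `G` correspond exactly to
the edges of `H`. -/
def IsIsomorphic {α : Type u} {β : Type v} (G : Hypergraph α) (H : Hypergraph β) : Prop :=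
  ∃ f : G.vertexSet ≃ H.vertexSet, ∀ e : Set G.vertexSet,
    Subtype.val '' e ∈ G.edgeSet ↔ Subtype.val '' (f '' e) ∈ H.edgeSet

/-- The `k`-uniform hyperstar of order `n` (for `k ≥ 2` and `n - 1` a multiple of `k - 1`). Its
center is `none`; the other vertices `some (i, j)` fall into `m = (n - 1) / (k - 1)` disjoint sets
`V_i` of size `k - 1`, where `V_i` collects the vertices with first index `i`; the edges are the
sets `{center} ∪ V_i`. -/
def hyperstar (n k : ℕ) : Hypergraph (Option (Fin ((n - 1) / (k - 1)) × Fin (k - 1))) where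
  vertexSet := Set.univ
  edgeSet := Set.range fun i => {none} ∪ Set.range fun j => some (i, j)
  subset_vertexSet_of_mem_edgeSet' := fun _ _ => Set.subset_univ _

instance hyperstar.instFintypeVertexSet (n k : ℕ) : Fintype (hyperstar n k).vertexSet :=
  inferInstanceAs
    (Fintype (Set.univ : Set (Option (Fin ((n - 1) / (k - 1)) × Fin (k - 1)))))

end Hypergraph

/-! Write `N = n - 1`. In the hyperstar, the vector with value `N` at the centre and `ρ` at every
other vertex is a positive eigenvector of the distance matrix exactly when `ρ ^ 2 = (2 * N - k) * ρ
+ N`; `starRadius` is the positive root. For an arbitrary hypertree the same vector, with `N` at a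
chosen root `r`, serves as test vector.

If some vertex lies in all edges, all distances are at most those of the star, and
`Matrix.sSup_hasEigenvalue_le` gives `ρ` as an upper bound. The Rayleigh quotient gives the lower
bound: root the tree at `r` and call a vertex deep if its parent is not `r`. Compared with the star,
each deep vertex adds at least 1 to the distances from `r`, but its parent is a non-root vertex at
distance 1 instead of 2. That loss is offset by a non-root vertex in another branch at distance at
least 3. The surplus from `r` remains, so the inequality is strict as soon as a deep vertex exists
(`starRadius_le_of_rooting`).

The partner in another branch exists when `r` lies in two edges (`exists_three_le_dist`). If no
vertex lies in all edges, such an `r` can be found, and deep vertices exist for every root.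
Otherwise the hypertree is a hyperstar. -/

/-! ### Bounds for the largest eigenvalue of a symmetric matrix. -/

open Matrix in
/-- A real symmetric matrix has Rayleigh quotients at most its largest eigenvalue. -/
theorem Matrix.dotProduct_mulVec_le_sSup_hasEigenvalue {V : Type*} [Fintype V]
    {M : Matrix V V ℝ} (hM : M.IsSymm) (x : V → ℝ) :
    x ⬝ᵥ (M *ᵥ x) ≤ sSup {μ : ℝ | Module.End.HasEigenvalue M.mulVecLin μ} * (x ⬝ᵥ x) := by
  classical
  set t := sSup {μ : ℝ | Module.End.HasEigenvalue M.mulVecLin μ} with ht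
  have hN : (t • (1 : Matrix V V ℝ) - M).IsHermitian := by
    rw [Matrix.IsHermitian, Matrix.conjTranspose_eq_transpose_of_trivial, Matrix.transpose_sub,
      Matrix.transpose_smul, Matrix.transpose_one, hM.eq]
  -- An eigenvalue `s` of `t • 1 - M` makes `t - s` an eigenvalue of `M`, hence `t - s ≤ t`.
  have hpsd : (t • (1 : Matrix V V ℝ) - M).PosSemidef := by
    rw [hN.posSemidef_iff_eigenvalues_nonneg]
    intro i
    have h := hN.mulVec_eigenvectorBasis i
    have hne : (hN.eigenvectorBasis i).ofLp ≠ 0 := fun h0 =>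
      hN.eigenvectorBasis.orthonormal.ne_zero i ((WithLp.ofLp_eq_zero 2).1 h0)
    rw [Matrix.sub_mulVec, Matrix.smul_mulVec, Matrix.one_mulVec] at h
    have hev : Module.End.HasEigenvalue M.mulVecLin (t - hN.eigenvalues i) := by
      refine Module.End.hasEigenvalue_of_hasEigenvector
        (x := (hN.eigenvectorBasis i).ofLp) ⟨?_, hne⟩
      rw [Module.End.mem_eigenspace_iff, Matrix.mulVecLin_apply, sub_smul, ← h]
      simp
    have := le_csSup (Module.End.finite_hasEigenvalue M.mulVecLin).bddAbove hev
    simp only [Pi.zero_apply]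
    linarith
  have h := hpsd.dotProduct_mulVec_nonneg x
  rw [Matrix.sub_mulVec, Matrix.smul_mulVec, Matrix.one_mulVec, dotProduct_sub,
    dotProduct_smul, star_trivial, smul_eq_mul] at h
  linarith

open Matrix in
/-- If a nonnegative symmetric matrix `M` satisfies `M x ≤ ρ x` for a positive vector `x`, then
its largest eigenvalue is at most `ρ`. -/
theorem Matrix.sSup_hasEigenvalue_le {V : Type*} [Fintype V] {M : Matrix V V ℝ}
    (hM : M.IsSymm) (hM0 : ∀ i j, 0 ≤ M i j) {x : V → ℝ} (hx : ∀ i, 0 < x i) {ρ : ℝ}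
    (hρ : 0 ≤ ρ) (h : ∀ i, (M *ᵥ x) i ≤ ρ * x i) :
    sSup {μ : ℝ | Module.End.HasEigenvalue M.mulVecLin μ} ≤ ρ := by
  -- `0 ≤ ρ` covers empty `V`, where the supremum of the empty set is 0.
  refine Real.sSup_le ?_ hρ
  intro μ hμ
  obtain ⟨y, hy⟩ := hμ.exists_hasEigenvector
  have hy1 : M *ᵥ y = μ • y := by simpa using hy.apply_eq_smul
  have hy0 := hy.2
  have key : ∀ i, μ * |y i| ≤ ∑ j, M i j * |y j| := fun i => calc
    μ * |y i| ≤ |μ * y i| := by rw [abs_mul]; gcongr; exact le_abs_self μ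
    _ = |∑ j, M i j * y j| := by
      rw [← smul_eq_mul, ← Pi.smul_apply, ← hy1]; rfl
    _ ≤ ∑ j, |M i j * y j| := Finset.abs_sum_le_sum_abs _ _
    _ = _ := Finset.sum_congr rfl fun j _ => by rw [abs_mul, abs_of_nonneg (hM0 i j)]
  -- Pair with `x` and use symmetry to move `M` from `|y|` onto `x`, where `M x ≤ ρ x` applies.
  have h1 : ∑ i, x i * (μ * |y i|) ≤ ∑ i, x i * ∑ j, M i j * |y j| :=
    Finset.sum_le_sum fun i _ => mul_le_mul_of_nonneg_left (key i) (hx i).le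
  have h2 : ∑ i, x i * ∑ j, M i j * |y j| = ∑ j, (M *ᵥ x) j * |y j| := by
    simp only [Matrix.mulVec, dotProduct, Finset.mul_sum, Finset.sum_mul]
    rw [Finset.sum_comm]
    refine Finset.sum_congr rfl fun i _ => Finset.sum_congr rfl fun j _ => ?_
    rw [hM.apply i j]; ring
  have h3 : ∑ j, (M *ᵥ x) j * |y j| ≤ ∑ j, ρ * x j * |y j| :=
    Finset.sum_le_sum fun j _ => mul_le_mul_of_nonneg_right (h j) (abs_nonneg _)
  have hpos : 0 < ∑ i, x i * |y i| := by
    obtain ⟨i, hi⟩ := Function.ne_iff.1 hy0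
    exact Finset.sum_pos' (fun i _ => mul_nonneg (hx i).le (abs_nonneg _))
      ⟨i, Finset.mem_univ _, mul_pos (hx i) (abs_pos.2 hi)⟩
  have h4 : ∑ i, x i * (μ * |y i|) = μ * ∑ i, x i * |y i| := by
    rw [Finset.mul_sum]; exact Finset.sum_congr rfl fun i _ => by ring
  have h5 : ∑ j, ρ * x j * |y j| = ρ * ∑ i, x i * |y i| := by
    rw [Finset.mul_sum]; exact Finset.sum_congr rfl fun i _ => by ring
  exact le_of_mul_le_mul_right (by linarith) hpos

/-! ### The quadratic form of a rooted distance matrix. -/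

/-- Splitting a double sum at a distinguished index. -/
theorem Finset.sum_sum_eq_erase_erase {V : Type*} [Fintype V] [DecidableEq V] (r : V)
    (f : V → V → ℝ) :
    ∑ u, ∑ v, f u v = f r r + ∑ v ∈ univ.erase r, f r v + ∑ u ∈ univ.erase r, f u r
      + ∑ u ∈ univ.erase r, ∑ v ∈ univ.erase r, f u v := by
  rw [← Finset.add_sum_erase _ _ (Finset.mem_univ r), ← Finset.add_sum_erase _ _ (Finset.mem_univ r)]
  have : ∀ u, ∑ v, f u v = f u r + ∑ v ∈ univ.erase r, f u v := fun u =>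
    (Finset.add_sum_erase _ _ (Finset.mem_univ r)).symm
  simp only [this, Finset.sum_add_distrib]
  ring

/-- Lower bound for the quadratic form of the distance matrix of a rooted hypertree: `pe` sends a
vertex to the edge towards the root `r`, `par` to the vertex of that edge closest to `r`, and `φ`
sends each vertex at distance at least two from `r` to some vertex in a different branch. -/
theorem quadraticForm_rooted_lower_bound {V E : Type*} [Fintype V] [DecidableEq V] [DecidableEq E]
    (r : V) (d : V → V → ℝ) (pe : V → E) (par φ : V → V) {k N : ℕ} {a b : ℝ}
    (ha : 0 ≤ a) (hb : 0 ≤ b)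
    (hN : (Finset.univ.erase r).card = N)
    (hrr : 0 ≤ d r r)
    (hr : ∀ v, v ≠ r → 1 + (if par v ≠ r then 1 else 0) ≤ d r v)
    (hsymm : ∀ u v, d u v = d v u)
    (hd : ∀ u v, u ≠ r → v ≠ r → 2 - (if u = v then 1 else 0) - (if pe u = pe v then 1 else 0)
      - (if u = par v then 1 else 0) - (if v = par u then 1 else 0)
      + (if par v ≠ r ∧ u = φ v then 1 else 0) + (if par u ≠ r ∧ v = φ u then 1 else 0) ≤ d u v)
    (hfib : ∀ v, v ≠ r → ((Finset.univ.erase r).filter fun u => pe v = pe u).card = k)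
    (hφ : ∀ v, v ≠ r → par v ≠ r → φ v ≠ r) :
    2 * a * b * (N + ((Finset.univ.erase r).filter fun v => par v ≠ r).card)
      + b ^ 2 * N * (2 * N - 1 - k) ≤
      ∑ u, ∑ v, (if u = r then a else b) * d u v * (if v = r then a else b) := by
  set W := Finset.univ.erase r with hW
  have memW : ∀ {v}, v ∈ W → v ≠ r := fun h => Finset.ne_of_mem_erase h
  have mkW : ∀ {v}, v ≠ r → v ∈ W := fun h => Finset.mem_erase.2 ⟨h, Finset.mem_univ _⟩
  set D : ℝ := ((W.filter fun v => par v ≠ r).card : ℝ) with hD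
  have hDsum : D = ∑ v ∈ W, (if par v ≠ r then (1 : ℝ) else 0) := by
    rw [hD, Finset.card_filter]; push_cast; rfl
  have hWsum : ∑ v ∈ W, (1 : ℝ) = N := by simp [hN]
  rw [Finset.sum_sum_eq_erase_erase r]
  have e1 : ∑ v ∈ W, (if r = r then a else b) * d r v * (if v = r then a else b)
      = a * b * ∑ v ∈ W, d r v := by
    rw [Finset.mul_sum]
    exact Finset.sum_congr rfl fun v hv => by rw [if_pos rfl, if_neg (memW hv)]; ring
  have e2 : ∑ v ∈ W, (if v = r then a else b) * d v r * (if r = r then a else b)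
      = a * b * ∑ v ∈ W, d r v := by
    rw [Finset.mul_sum]
    exact Finset.sum_congr rfl fun v hv => by
      rw [if_pos rfl, if_neg (memW hv), hsymm v r]; ring
  have e3 : ∑ u ∈ W, ∑ v ∈ W, (if u = r then a else b) * d u v * (if v = r then a else b)
      = b ^ 2 * ∑ u ∈ W, ∑ v ∈ W, d u v := by
    simp only [Finset.mul_sum]
    exact Finset.sum_congr rfl fun u hu => Finset.sum_congr rfl fun v hv => by
      rw [if_neg (memW hu), if_neg (memW hv)]; ring
  rw [e1, e2, e3]
  have s1 : (N : ℝ) + D ≤ ∑ v ∈ W, d r v := by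
    rw [hDsum, ← hWsum, ← Finset.sum_add_distrib]
    exact Finset.sum_le_sum fun v hv => hr v (memW hv)
  -- The two parent indicators cost `2 * D` in total and the two `φ` indicators return `2 * D`, so
  -- `D` cancels.
  have s2 : (N : ℝ) * (2 * N - 1 - k) ≤ ∑ u ∈ W, ∑ v ∈ W, d u v := by
    have hle := Finset.sum_le_sum fun u (hu : u ∈ W) => Finset.sum_le_sum fun v (hv : v ∈ W) =>
      hd u v (memW hu) (memW hv)
    refine le_trans (le_of_eq ?_) hle
    simp only [Finset.sum_add_distrib, Finset.sum_sub_distrib]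
    have t0 : ∑ u ∈ W, ∑ v ∈ W, (2 : ℝ) = 2 * N * N := by simp [hN]; ring
    have t1 : ∑ u ∈ W, ∑ v ∈ W, (if u = v then (1 : ℝ) else 0) = N := by
      rw [← hWsum]
      exact Finset.sum_congr rfl fun u hu => by rw [Finset.sum_ite_eq, if_pos hu]
    have t2 : ∑ u ∈ W, ∑ v ∈ W, (if pe u = pe v then (1 : ℝ) else 0) = N * k := by
      rw [← hWsum, Finset.sum_mul]
      refine Finset.sum_congr rfl fun u hu => ?_
      rw [Finset.sum_boole, hfib u (memW hu), one_mul]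
    have aux : ∀ g : V → V, (∀ v ∈ W, par v ≠ r → g v ≠ r) →
        ∑ v ∈ W, ∑ u ∈ W, (if par v ≠ r ∧ u = g v then (1 : ℝ) else 0) = D := by
      intro g hg
      rw [hDsum]
      refine Finset.sum_congr rfl fun v hv => ?_
      by_cases h : par v ≠ r
      · simp only [h, ne_eq, not_false_eq_true, true_and, if_true]
        rw [Finset.sum_ite_eq', if_pos (mkW (hg v hv h))]
      · simp [h]
    -- A parent is counted only if it lies in `W`, that is, for deep `v`.
    have t3 : ∑ v ∈ W, ∑ u ∈ W, (if u = par v then (1 : ℝ) else 0) = D := by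
      rw [← aux par fun _ _ h => h]
      refine Finset.sum_congr rfl fun v hv => Finset.sum_congr rfl fun u hu => ?_
      refine if_congr ⟨fun h => ⟨h ▸ memW hu, h⟩, fun h => h.2⟩ rfl rfl
    have t4 := aux φ fun v hv h => hφ v (memW hv) h
    have t3' : ∑ u ∈ W, ∑ v ∈ W, (if u = par v then (1 : ℝ) else 0) = D := by
      rw [Finset.sum_comm, t3]
    have t4' : ∑ u ∈ W, ∑ v ∈ W, (if par v ≠ r ∧ u = φ v then (1 : ℝ) else 0) = D := by
      rw [Finset.sum_comm, t4]
    rw [t0, t1, t2, t3, t3', t4, t4']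
    ring
  have h0 : 0 ≤ (if r = r then a else b) * d r r * (if r = r then a else b) := by
    rw [if_pos rfl]; positivity
  have h1 := mul_le_mul_of_nonneg_left s1 (mul_nonneg ha hb)
  have h2 := mul_le_mul_of_nonneg_left s2 (sq_nonneg b)
  linarith

/-! ### Walks and distances in hypergraphs. -/

namespace Hypergraph

universe u

variable {α : Type u} {G : Hypergraph α}

namespace Walk

/-- Extend a walk by one edge at its end. -/
def snoc : {a b c : α} → (p : G.Walk a b) → (e : Set α) → e ∈ G.edgeSet → b ∈ e → c ∈ e →
    b ≠ c → G.Walk a c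
  | _, _, _, nil _, e, he, hb, hc, hbc =>
      cons e he hb hc hbc (nil (G.subset_vertexSet_of_mem_edgeSet' he hc))
  | _, _, _, cons e' he' ha' hb' hab' p, e, he, hb, hc, hbc =>
      cons e' he' ha' hb' hab' (p.snoc e he hb hc hbc)

/-- The reverse of a walk. -/
def reverse : {a b : α} → G.Walk a b → G.Walk b a
  | _, _, nil ha => nil ha
  | _, _, cons e he ha hb hab p => p.reverse.snoc e he hb ha hab.symm

variable {a b c : α}

theorem length_snoc (p : G.Walk a b) (e : Set α) (he : e ∈ G.edgeSet) (hb : b ∈ e) (hc : c ∈ e)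
    (hbc : b ≠ c) : (p.snoc e he hb hc hbc).length = p.length + 1 := by
  induction p with
  | nil => rfl
  | cons e' he' ha' hb' hab' p ih => simp [snoc, length, ih]

theorem support_snoc (p : G.Walk a b) (e : Set α) (he : e ∈ G.edgeSet) (hb : b ∈ e) (hc : c ∈ e)
    (hbc : b ≠ c) : (p.snoc e he hb hc hbc).support = p.support ++ [c] := by
  induction p with
  | nil => rfl
  | cons e' he' ha' hb' hab' p ih => simp [snoc, support, ih]

theorem edges_snoc (p : G.Walk a b) (e : Set α) (he : e ∈ G.edgeSet) (hb : b ∈ e) (hc : c ∈ e)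
    (hbc : b ≠ c) : (p.snoc e he hb hc hbc).edges = p.edges ++ [e] := by
  induction p with
  | nil => rfl
  | cons e' he' ha' hb' hab' p ih => simp [snoc, edges, ih]

theorem length_reverse (p : G.Walk a b) : p.reverse.length = p.length := by
  induction p with
  | nil => rfl
  | cons e he ha hb hab p ih => rw [reverse, length_snoc, ih, length]

theorem support_reverse (p : G.Walk a b) : p.reverse.support = p.support.reverse := by
  induction p with
  | nil => rfl
  | cons e he ha hb hab p ih => rw [reverse, support_snoc, ih, support, List.reverse_cons]

theorem edges_reverse (p : G.Walk a b) : p.reverse.edges = p.edges.reverse := by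
  induction p with
  | nil => rfl
  | cons e he ha hb hab p ih => rw [reverse, edges_snoc, ih, edges, List.reverse_cons]

theorem IsPath.reverse {p : G.Walk a b} (hp : p.IsPath) : p.reverse.IsPath := by
  rw [IsPath, support_reverse, edges_reverse]
  exact ⟨List.nodup_reverse.2 hp.1, List.nodup_reverse.2 hp.2⟩

end Walk

theorem dist_comm (G : Hypergraph α) (a b : α) : G.dist a b = G.dist b a := by
  unfold dist
  congr 1
  ext l
  constructor <;> rintro ⟨p, hp, rfl⟩ <;> exact ⟨p.reverse, hp.reverse, p.length_reverse⟩

theorem distMatrix_isSymm (G : Hypergraph α) : G.distMatrix.IsSymm := by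
  ext a b
  simp [distMatrix, G.dist_comm a b]

theorem dist_le_length {a b : α} {p : G.Walk a b} (hp : p.IsPath) : G.dist a b ≤ p.length :=
  Nat.sInf_le ⟨p, hp, rfl⟩

theorem dist_self_eq_zero {a : α} (ha : a ∈ G.vertexSet) : G.dist a a = 0 :=
  Nat.le_zero.1 (dist_le_length (p := Walk.nil ha) (by simp [Walk.IsPath, Walk.support, Walk.edges]))

theorem dist_le_one {a b : α} {e : Set α} (he : e ∈ G.edgeSet) (ha : a ∈ e) (hb : b ∈ e) :
    G.dist a b ≤ 1 := by
  by_cases hab : a = b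
  · subst hab
    rw [dist_self_eq_zero (G.subset_vertexSet_of_mem_edgeSet' he ha)]
    exact zero_le_one
  · exact dist_le_length (p := .cons e he ha hb hab
      (.nil (G.subset_vertexSet_of_mem_edgeSet' he hb)))
      (by simp [Walk.IsPath, Walk.support, Walk.edges, hab])

theorem exists_isPath_length_two {a b c : α} {e f : Set α} (he : e ∈ G.edgeSet)
    (hf : f ∈ G.edgeSet) (ha : a ∈ e) (hb : b ∈ e) (hb' : b ∈ f) (hc : c ∈ f) (hab : a ≠ b)
    (hbc : b ≠ c) (hac : a ≠ c) (hef : e ≠ f) : ∃ p : G.Walk a c, p.IsPath ∧ p.length = 2 :=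
  ⟨.cons e he ha hb hab (.cons f hf hb' hc hbc (.nil (G.subset_vertexSet_of_mem_edgeSet' hf hc))),
    by simp [Walk.IsPath, Walk.support, Walk.edges, *], rfl⟩

theorem dist_le_two {a b c : α} {e f : Set α} (he : e ∈ G.edgeSet) (hf : f ∈ G.edgeSet)
    (ha : a ∈ e) (hb : b ∈ e) (hb' : b ∈ f) (hc : c ∈ f) : G.dist a c ≤ 2 := by
  by_cases hef : e = f
  · subst hef; exact (dist_le_one he ha hc).trans one_le_two
  by_cases hab : a = b
  · subst hab; exact (dist_le_one hf hb' hc).trans one_le_two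
  by_cases hbc : b = c
  · subst hbc; exact (dist_le_one he ha hb).trans one_le_two
  by_cases hac : a = c
  · subst hac; exact (dist_le_one he ha ha).trans one_le_two
  obtain ⟨p, hp, hl⟩ := exists_isPath_length_two he hf ha hb hb' hc hab hbc hac hef
  exact hl ▸ dist_le_length hp

theorem IsConnected.le_dist (hG : G.IsConnected) {a b : α} (ha : a ∈ G.vertexSet)
    (hb : b ∈ G.vertexSet) {m : ℕ} (h : ∀ p : G.Walk a b, m ≤ p.length) : m ≤ G.dist a b := by
  obtain ⟨p, hp⟩ := hG.2 a ha b hb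
  refine le_csInf ⟨p.length, p, hp, rfl⟩ ?_
  rintro _ ⟨q, -, rfl⟩
  exact h q

theorem IsConnected.one_le_dist (hG : G.IsConnected) {a b : α} (ha : a ∈ G.vertexSet)
    (hb : b ∈ G.vertexSet) (hab : a ≠ b) : 1 ≤ G.dist a b := by
  refine hG.le_dist ha hb fun p => ?_
  cases p with
  | nil => exact absurd rfl hab
  | cons => simp [Walk.length]

theorem IsConnected.two_le_dist (hG : G.IsConnected) {a b : α} (ha : a ∈ G.vertexSet)
    (hb : b ∈ G.vertexSet) (hab : a ≠ b) (h : ∀ e ∈ G.edgeSet, a ∈ e → b ∉ e) :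
    2 ≤ G.dist a b := by
  refine hG.le_dist ha hb fun p => ?_
  cases p with
  | nil => exact absurd rfl hab
  | cons e he ha' hb' hab' q =>
    cases q with
    | nil => exact absurd hb' (h e he ha')
    | cons => simp [Walk.length]

end Hypergraph

/-! ### Incidence graphs and rootings of hypertrees. -/

/-- In a tree, the neighbour of `v` that is closer to a given vertex is unique. -/
theorem SimpleGraph.IsTree.eq_of_adj_of_dist_add_one {V : Type*} {B : SimpleGraph V}
    (hB : B.IsTree) {u v w w' : V} (hw : B.Adj v w) (hw' : B.Adj v w')
    (hd : B.dist u w + 1 = B.dist u v) (hd' : B.dist u w' + 1 = B.dist u v) : w = w' := by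
  obtain ⟨p, hp, hpl⟩ := hB.connected.exists_path_of_dist u v
  have key : ∀ z, B.Adj v z → B.dist u z + 1 = B.dist u v → z = p.penultimate := by
    intro z hz hdz
    refine hB.isAcyclic.eq_penultimate_of_adj_end hp hz ?_
    by_contra hzp
    obtain ⟨q, hq, hql⟩ := hB.connected.exists_path_of_dist u z
    -- If `z` were off `p`, the path to `z` would be `p` plus one edge, so `z` would be farther from
    -- `u` than `v`.
    have hvq := hB.isAcyclic.mem_support_of_ne_mem_support_of_adj_of_isPath hq hp hz.symm hzp
    have := hB.isAcyclic.path_concat hp hq hz hvq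
    rw [this, SimpleGraph.Walk.length_concat] at hql
    omega
  rw [key w hw hd, key w' hw' hd']

namespace Hypergraph

universe u

variable {α : Type u} {G : Hypergraph α}

/-- The bipartite incidence graph of a hypergraph. -/
def incidenceGraph (G : Hypergraph α) : SimpleGraph (G.vertexSet ⊕ G.edgeSet) where
  Adj
    | .inl v, .inr e => (v : α) ∈ (e : Set α)
    | .inr e, .inl v => (v : α) ∈ (e : Set α)
    | _, _ => False
  symm := ⟨by rintro (v | e) (w | f) h <;> exact h⟩
  loopless := ⟨by rintro (v | e) h <;> exact h⟩

theorem incidenceGraph_adj_inl_inr {v : G.vertexSet} {e : G.edgeSet} :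
    G.incidenceGraph.Adj (.inl v) (.inr e) ↔ (v : α) ∈ (e : Set α) := Iff.rfl

/-- A walk in a hypergraph gives a walk of twice its length in the incidence graph. -/
theorem Walk.exists_incidenceGraph_walk {a b : α} (p : G.Walk a b) (ha : a ∈ G.vertexSet)
    (hb : b ∈ G.vertexSet) :
    ∃ q : G.incidenceGraph.Walk (.inl ⟨a, ha⟩) (.inl ⟨b, hb⟩), q.length = 2 * p.length := by
  induction p with
  | nil => exact ⟨.nil, rfl⟩
  | @cons a b c e he ha' hb' hab p ih =>
    obtain ⟨q, hq⟩ := ih (G.subset_vertexSet_of_mem_edgeSet' he hb') hb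
    have h1 : G.incidenceGraph.Adj (.inl ⟨a, ha⟩) (.inr ⟨e, he⟩) := ha'
    have h2 : G.incidenceGraph.Adj (.inr ⟨e, he⟩)
      (.inl ⟨b, G.subset_vertexSet_of_mem_edgeSet' he hb'⟩) := hb'
    refine ⟨.cons h1 (.cons h2 q), ?_⟩
    simp [Walk.length, hq]
    ring

theorem Walk.one_le_length {a b : α} (p : G.Walk a b) (hab : a ≠ b) : 1 ≤ p.length := by
  cases p with
  | nil => exact absurd rfl hab
  | cons => simp [Walk.length]

/-- A path between vertices in the incidence graph gives a path in the hypergraph. -/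
theorem exists_isPath_of_incidenceGraph_isPath (n : ℕ) :
    ∀ {u v : G.vertexSet} (p : G.incidenceGraph.Walk (.inl u) (.inl v)), p.IsPath → p.length ≤ n →
      ∃ q : G.Walk u v, q.IsPath ∧ 2 * q.length = p.length ∧
        (∀ x ∈ q.support, ∃ h : x ∈ G.vertexSet, .inl ⟨x, h⟩ ∈ p.support) ∧
        ∀ e ∈ q.edges, ∃ h : e ∈ G.edgeSet, .inr ⟨e, h⟩ ∈ p.support := by
  -- Each step peels off vertex, edge, vertex; the two support clauses show that the peeled vertex
  -- and edge do not recur.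
  induction n using Nat.strong_induction_on with
  | _ n ih =>
    intro u v p hp hn
    cases p with
    | nil =>
      exact ⟨.nil u.2, by simp [Walk.IsPath, Walk.support, Walk.edges], rfl,
        by simp [Walk.support], by simp [Walk.edges]⟩
    | @cons _ y _ h p =>
      cases p with
      | nil => exact h.elim
      | @cons _ z _ h' p =>
        rcases y with y | e
        · exact h.elim
        rcases z with w | f
        swap
        · exact h'.elim
        simp only [SimpleGraph.Walk.cons_isPath_iff, SimpleGraph.Walk.support_cons,
          List.mem_cons, not_or, SimpleGraph.Walk.length_cons] at hp hn
        obtain ⟨⟨hp, he⟩, -, hu⟩ := hp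
        obtain ⟨q, hq, hl, hs, hes⟩ := ih p.length (by omega) p hp le_rfl
        have huw : (u : α) ≠ w := fun huw => hu (by
          rw [Subtype.ext huw]; exact p.start_mem_support)
        refine ⟨.cons e e.2 h h' huw q, ⟨?_, ?_⟩, ?_, ?_, ?_⟩
        · simp only [Walk.support, List.nodup_cons]
          exact ⟨fun hx => hu (hs _ hx).2, hq.1⟩
        · simp only [Walk.edges, List.nodup_cons]
          exact ⟨fun hx => he (hes _ hx).2, hq.2⟩
        · simp only [Walk.length, SimpleGraph.Walk.length_cons, ← hl]; ring
        · intro x hx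
          simp only [Walk.support, List.mem_cons] at hx
          rcases hx with rfl | hx
          · exact ⟨u.2, by simp⟩
          · obtain ⟨h1, h2⟩ := hs x hx
            exact ⟨h1, by simp [h2]⟩
        · intro x hx
          simp only [Walk.edges, List.mem_cons] at hx
          rcases hx with rfl | hx
          · exact ⟨e.2, by simp⟩
          · obtain ⟨h1, h2⟩ := hes x hx
            exact ⟨h1, by simp [h2]⟩

/-- Removing the first two steps `u, e, w` of a cycle leaves a path from `w` to `u` that avoids `e`;
its hypergraph version, closed up by `e`, is a forbidden cycle. Here `u ≠ w`, since otherwise the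
first step would be retraced. -/
theorem not_isCycle_incidenceGraph_inl (hG : ∀ (a : α) (p : G.Walk a a), ¬ p.IsCycle)
    {u : G.vertexSet} (p : G.incidenceGraph.Walk (.inl u) (.inl u)) : ¬ p.IsCycle := by
  intro hc
  cases p with
  | nil => exact hc.ne_nil rfl
  | @cons _ y _ h p =>
    rw [SimpleGraph.Walk.cons_isCycle_iff] at hc
    obtain ⟨hp, hup⟩ := hc
    cases p with
    | nil => exact h.elim
    | @cons _ z _ h' p =>
      rcases y with y | e
      · exact h.elim
      rcases z with w | f
      swap
      · exact h'.elim
      rw [SimpleGraph.Walk.cons_isPath_iff] at hp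
      obtain ⟨q, hq, hl, hs, hes⟩ := exists_isPath_of_incidenceGraph_isPath _ p hp.1 le_rfl
      have huw : (u : α) ≠ w := fun huw => hup (by
        have : w = u := Subtype.ext huw.symm
        simp [this, Sym2.eq_swap])
      refine hG u (.cons e e.2 h h' huw q) ⟨?_, ?_, ?_⟩
      · exact Nat.succ_le_succ (q.one_le_length huw.symm)
      · simp only [Walk.edges, List.nodup_cons]
        exact ⟨fun hx => hp.2 (hes _ hx).2, hq.2⟩
      · simpa [Walk.support] using hq.1

/-- Nonemptiness attaches each edge node to a vertex node. A cycle based at an edge node is rotated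
to one based at a vertex node. -/
theorem IsHypertree.isTree_incidenceGraph (hG : G.IsHypertree)
    (hne : ∀ e ∈ G.edgeSet, e.Nonempty) : G.incidenceGraph.IsTree := by
  classical
  obtain ⟨⟨⟨r, hr⟩, hconn⟩, hcyc⟩ := hG
  refine ⟨?_, ?_⟩
  · rw [SimpleGraph.connected_iff_exists_forall_reachable]
    have key : ∀ v : G.vertexSet, G.incidenceGraph.Reachable (.inl ⟨r, hr⟩) (.inl v) := by
      intro v
      obtain ⟨p, -⟩ := hconn r hr v v.2
      obtain ⟨q, -⟩ := p.exists_incidenceGraph_walk hr v.2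
      exact ⟨q⟩
    refine ⟨.inl ⟨r, hr⟩, ?_⟩
    rintro (v | e)
    · exact key v
    · obtain ⟨v, hv⟩ := hne e e.2
      exact (key ⟨v, G.subset_vertexSet_of_mem_edgeSet' e.2 hv⟩).trans
        (SimpleGraph.Adj.reachable (incidenceGraph_adj_inl_inr.2 hv))
  · rintro (v | e) p hp
    · exact not_isCycle_incidenceGraph_inl hcyc p hp
    · cases p with
      | nil => exact hp.ne_nil rfl
      | @cons _ y _ h p =>
        rcases y with v | f
        swap
        · exact h.elim
        have hv : (.inl v) ∈ (SimpleGraph.Walk.cons h p).support := by simp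
        exact not_isCycle_incidenceGraph_inl hcyc _ (hp.rotate hv)

/-- Rooting of a hypertree at `r`: `pv e` is the vertex of the edge `e` that is closest to `r`, and
`pe v` is the first edge on the path from `v` to `r`. -/
theorem IsHypertree.exists_rooting (hG : G.IsHypertree) (hne : ∀ e ∈ G.edgeSet, e.Nonempty)
    (r : G.vertexSet) (hE : Nonempty G.edgeSet) :
    ∃ (pe : G.vertexSet → G.edgeSet) (pv : G.edgeSet → G.vertexSet),
      (∀ e : G.edgeSet, (pv e : α) ∈ (e : Set α)) ∧
      (∀ v, v ≠ r → ∀ e, pe v = e ↔ (v : α) ∈ (e : Set α) ∧ v ≠ pv e) ∧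
      ∀ e : G.edgeSet, (r : α) ∈ (e : Set α) → pv e = r := by
  have hB := hG.isTree_incidenceGraph hne
  set B := G.incidenceGraph with hBdef
  set δ := B.dist (.inl r) with hδ
  have hpar : ∀ x, x ≠ .inl r → ∃ y, B.Adj x y ∧ δ y + 1 = δ x := by
    intro x hx
    obtain ⟨p, hp⟩ := hB.connected.exists_walk_length_eq_dist x (.inl r)
    cases p with
    | nil => exact absurd rfl hx
    | @cons _ y _ h p =>
      refine ⟨y, h, ?_⟩
      have h1 : δ y ≤ p.length := by
        rw [hδ, SimpleGraph.dist_comm]; exact SimpleGraph.dist_le p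
      have h2 : δ x = p.length + 1 := by
        rw [hδ, SimpleGraph.dist_comm, ← hp, SimpleGraph.Walk.length_cons]
      have h3 : δ x = δ y + 1 ∨ δ y = δ x + 1 := hB.dist_eq_dist_add_one_of_adj (.inl r) h
      omega
  have hv : ∀ v : G.vertexSet, ∃ e : G.edgeSet, v ≠ r →
      (v : α) ∈ (e : Set α) ∧ δ (.inr e) + 1 = δ (.inl v) := by
    intro v
    by_cases h : v = r
    -- The root has no parent edge; `pe r` is an arbitrary edge.
    · exact ⟨hE.some, fun h' => absurd h h'⟩
    · obtain ⟨y | e, h1, h2⟩ := hpar (.inl v) (fun h' => h (Sum.inl_injective h'))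
      · exact h1.elim
      · exact ⟨e, fun _ => ⟨h1, h2⟩⟩
  have he : ∀ e : G.edgeSet, ∃ v : G.vertexSet, (v : α) ∈ (e : Set α) ∧
      δ (.inl v) + 1 = δ (.inr e) := by
    intro e
    obtain ⟨v | y, h1, h2⟩ := hpar (.inr e) (by simp)
    · exact ⟨v, h1, h2⟩
    · exact h1.elim
  choose pe hpe using hv
  choose pv hpv using he
  have huniq : ∀ {v : G.vertexSet} {e : G.edgeSet}, (v : α) ∈ (e : Set α) →
      δ (.inl v) + 1 = δ (.inr e) → v = pv e := fun {v e} h1 h2 =>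
    Sum.inl_injective (hB.eq_of_adj_of_dist_add_one (u := .inl r) (v := .inr e)
      h1 (hpv e).1 h2 (hpv e).2)
  refine ⟨pe, pv, fun e => (hpv e).1, fun v hvr e => ⟨?_, ?_⟩, fun e hre => ?_⟩
  · rintro rfl
    refine ⟨(hpe v hvr).1, fun h => ?_⟩
    have h1 := (hpe v hvr).2
    have h2 := (hpv (pe v)).2
    rw [← h] at h2
    omega
  -- The depths of `v` and `e` differ by exactly one: either `e` is the closer one and equals `pe
  -- v`, or `v` is and equals `pv e`.
  · rintro ⟨h1, h2⟩
    have h3 := hB.dist_eq_dist_add_one_of_adj (.inl r)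
      (incidenceGraph_adj_inl_inr (G := G) (v := v) (e := e) |>.2 h1)
    rcases h3 with h3 | h3
    · exact Sum.inr_injective (hB.eq_of_adj_of_dist_add_one (u := .inl r) (v := .inl v)
        (hpe v hvr).1 h1 (hpe v hvr).2 h3.symm)
    · exact absurd (huniq h1 h3.symm) h2
  · refine (huniq hre ?_).symm
    have h3 : δ (.inl r) = δ (.inr e) + 1 ∨ δ (.inr e) = δ (.inl r) + 1 :=
      hB.dist_eq_dist_add_one_of_adj (.inl r)
        (incidenceGraph_adj_inl_inr (G := G) (v := r) (e := e) |>.2 hre)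
    have h0 : δ (.inl r) = 0 := SimpleGraph.dist_self
    omega

/-- If `r` lies in two edges and `v` shares no edge with `r`, then some neighbour of `r` has
distance at least three from `v`. -/
theorem IsHypertree.exists_three_le_dist (hG : G.IsHypertree) {k : ℕ} (hk : 2 ≤ k)
    (hunif : G.IsUniform k) {r v : G.vertexSet} {e f : Set α} (he : e ∈ G.edgeSet)
    (hf : f ∈ G.edgeSet) (hef : e ≠ f) (hre : (r : α) ∈ e) (hrf : (r : α) ∈ f) (hvr : v ≠ r)
    (hv : ∀ g ∈ G.edgeSet, (r : α) ∈ g → (v : α) ∉ g) :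
    ∃ u : G.vertexSet, u ≠ r ∧ (∃ g ∈ G.edgeSet, (r : α) ∈ g ∧ (u : α) ∈ g) ∧
      3 ≤ G.dist u v := by
  have hne : ∀ e ∈ G.edgeSet, e.Nonempty := fun e he => by
    rw [Set.nonempty_iff_ne_empty]
    rintro rfl
    have := hunif _ he
    simp at this
    omega
  have hB := hG.isTree_incidenceGraph hne
  obtain ⟨p, hp, hpl⟩ := hB.connected.exists_path_of_dist (.inl r) (.inl v)
  have hlen : 3 ≤ p.length := by
    cases p with
    | nil => exact absurd rfl hvr
    | @cons _ y _ h p =>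
      rcases y with y | g
      · exact h.elim
      cases p with
      | @cons _ z _ h' p =>
        cases p with
        | nil => exact absurd h' (hv g g.2 h)
        | cons => simp
  -- The path leaves `r` through a single edge, so it misses `e` or `f`.
  obtain ⟨g, hg, hrg, hgp⟩ : ∃ g, ∃ hg : g ∈ G.edgeSet, (r : α) ∈ g ∧
      (.inr ⟨g, hg⟩) ∉ p.support := by
    by_contra! hcon
    have h1 := hB.isAcyclic.eq_snd_of_adj_start hp
      (incidenceGraph_adj_inl_inr (e := ⟨e, he⟩) |>.2 hre) (hcon e he hre)
    have h2 := hB.isAcyclic.eq_snd_of_adj_start hp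
      (incidenceGraph_adj_inl_inr (e := ⟨f, hf⟩) |>.2 hrf) (hcon f hf hrf)
    exact hef (congrArg Subtype.val (Sum.inr_injective (h1.trans h2.symm)))
  obtain ⟨u, hug, hur⟩ := Set.exists_ne_of_one_lt_ncard (s := g) (by rw [hunif g hg]; omega) (r : α)
  have huV := G.subset_vertexSet_of_mem_edgeSet' hg hug
  have hadj1 : G.incidenceGraph.Adj (.inr ⟨g, hg⟩) (.inl r) := hrg
  have hadj2 : G.incidenceGraph.Adj (.inl ⟨u, huV⟩) (.inr ⟨g, hg⟩) := hug
  have hp1 : (p.cons hadj1).IsPath := hp.cons hgp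
  have hup : (.inl ⟨u, huV⟩) ∉ (p.cons hadj1).support := by
    intro hmem
    have := hB.isAcyclic.eq_snd_of_adj_start hp1
      hadj2.symm hmem
    rw [SimpleGraph.Walk.snd_cons] at this
    exact hur (congrArg Subtype.val (Sum.inl_injective this))
  have hp2 : ((p.cons hadj1).cons hadj2).IsPath := hp1.cons hup
  refine ⟨⟨u, huV⟩, fun h => hur (congrArg Subtype.val h), ⟨g, hg, hrg, hug⟩,
    hG.1.le_dist huV v.2 fun q => ?_⟩
  obtain ⟨q', hq'⟩ := q.exists_incidenceGraph_walk huV v.2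
  obtain ⟨p', hp', hpl'⟩ := hB.connected.exists_path_of_dist (.inl ⟨u, huV⟩) (.inl v)
  -- The prolonged path has length at least 5 and is the only one, so `2 * q.length ≥ 5`.
  have := (hB.existsUnique_path _ _).unique hp2 hp'
  have h1 := SimpleGraph.dist_le q'
  rw [← hpl', ← this, SimpleGraph.Walk.length_cons, SimpleGraph.Walk.length_cons] at h1
  omega

end Hypergraph

/-! ### Comparing distance spectral radii with `starRadius`. -/

namespace Hypergraph

universe u

variable {α : Type u} {G : Hypergraph α}

/-- The distance spectral radius of the `k`-uniform hyperstar on `N + 1` vertices: the positive root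
of `ρ ^ 2 = (2 * N - k) * ρ + N`. -/
noncomputable def starRadius (N k : ℕ) : ℝ :=
  ((2 * N - k : ℝ) + √((2 * N - k : ℝ) ^ 2 + 4 * N)) / 2

theorem starRadius_pos {N : ℕ} (k : ℕ) (hN : 0 < N) : 0 < starRadius N k := by
  have hN' : (0 : ℝ) < N := Nat.cast_pos.2 hN
  have h : |(2 * N - k : ℝ)| < √((2 * N - k : ℝ) ^ 2 + 4 * N) := by
    rw [← Real.sqrt_sq_eq_abs]
    exact Real.sqrt_lt_sqrt (sq_nonneg _) (by linarith)
  have := neg_abs_le (2 * N - k : ℝ)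
  unfold starRadius
  linarith

theorem starRadius_sq (N k : ℕ) :
    starRadius N k ^ 2 = (2 * N - k) * starRadius N k + N := by
  have h := Real.sq_sqrt (show (0 : ℝ) ≤ (2 * N - k : ℝ) ^ 2 + 4 * N by positivity)
  unfold starRadius
  linear_combination h / 4

theorem IsUniform.card_filter_mem [Fintype G.vertexSet] {k : ℕ} (hG : G.IsUniform k)
    {e : Set α} (he : e ∈ G.edgeSet) [DecidablePred fun v : G.vertexSet => (v : α) ∈ e] :
    (Finset.univ.filter fun v : G.vertexSet => (v : α) ∈ e).card = k := by
  rw [← hG e he, ← Finset.card_map (Function.Embedding.subtype _), ← Set.ncard_coe_finset]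
  congr 1
  ext x
  simp only [Finset.coe_map, Finset.coe_filter, Set.mem_image]
  constructor
  · rintro ⟨y, hy, rfl⟩
    exact hy.2
  · exact fun hx => ⟨⟨x, G.subset_vertexSet_of_mem_edgeSet' he hx⟩, ⟨Finset.mem_univ _, hx⟩, rfl⟩

theorem IsUniform.card_filter_mem_erase [Fintype G.vertexSet] [DecidableEq G.vertexSet] {k : ℕ}
    (hG : G.IsUniform k) {e : Set α} (he : e ∈ G.edgeSet) {w : G.vertexSet} (hw : (w : α) ∈ e)
    [DecidablePred fun v : G.vertexSet => (v : α) ∈ e] :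
    ((Finset.univ.erase w).filter fun v : G.vertexSet => (v : α) ∈ e).card = k - 1 := by
  rw [Finset.filter_erase, Finset.card_erase_of_mem (by simpa using hw), hG.card_filter_mem he]

/-- Upper bound for the distance spectral radius of a hypergraph with a vertex in all edges. -/
theorem distSpectralRadius_le_starRadius [Fintype G.vertexSet] {k N : ℕ} (hk : 1 ≤ k)
    (hN : 0 < N) (hcard : Fintype.card G.vertexSet = N + 1) (hG : G.IsUniform k)
    (r : G.vertexSet) (hr : ∀ e ∈ G.edgeSet, (r : α) ∈ e)
    (hcov : ∀ v : G.vertexSet, v ≠ r → ∃ e ∈ G.edgeSet, (v : α) ∈ e) :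
    G.distSpectralRadius ≤ starRadius N k := by
  classical
  set ρ := starRadius N k with hρ
  have hρ0 : 0 < ρ := starRadius_pos k hN
  have hρ2 : ρ ^ 2 = (2 * N - k) * ρ + N := starRadius_sq N k
  have hN0 : (0 : ℝ) < N := Nat.cast_pos.2 hN
  have hWcard : (Finset.univ.erase r).card = N := by
    rw [Finset.card_erase_of_mem (Finset.mem_univ _), Finset.card_univ, hcard]; rfl
  refine Matrix.sSup_hasEigenvalue_le G.distMatrix_isSymm (fun i j => Nat.cast_nonneg _)
    (x := fun v => if v = r then (N : ℝ) else ρ) (fun v => by split_ifs <;> assumption) hρ0.le ?_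
  intro u
  have hsplit : (G.distMatrix.mulVec fun v => if v = r then (N : ℝ) else ρ) u
      = G.dist u r * N + ∑ v ∈ Finset.univ.erase r, (G.dist u v : ℝ) * ρ := by
    simp only [Matrix.mulVec, dotProduct]
    rw [← Finset.add_sum_erase _ _ (Finset.mem_univ r), if_pos rfl]
    congr 1
    exact Finset.sum_congr rfl fun v hv => by rw [if_neg (Finset.ne_of_mem_erase hv)]; rfl
  rw [hsplit]
  by_cases hu : u = r
  · subst hu
    rw [if_pos rfl, dist_self_eq_zero u.2]
    have : ∀ v ∈ Finset.univ.erase u, (G.dist u v : ℝ) * ρ ≤ ρ := fun v hv => by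
      obtain ⟨e, he, hve⟩ := hcov v (Finset.ne_of_mem_erase hv)
      have h1 : (G.dist u v : ℝ) ≤ 1 := by exact_mod_cast dist_le_one he (hr e he) hve
      nlinarith
    have := Finset.sum_le_sum this
    simp only [Finset.sum_const, hWcard, nsmul_eq_mul] at this
    push_cast
    linarith
  · rw [if_neg hu]
    obtain ⟨e, he, hue⟩ := hcov u hu
    have h1 : (G.dist u r : ℝ) ≤ 1 := by exact_mod_cast dist_le_one he hue (hr e he)
    -- At `v = u` both indicators fire. They sum to `1 + (k - 1)`, which turns `2 * N` into `2 * N -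
    -- k`.
    have h2 : ∀ v ∈ Finset.univ.erase r, (G.dist u v : ℝ) * ρ ≤
        (2 - (if u = v then 1 else 0) - (if (v : α) ∈ e then 1 else 0)) * ρ := fun v hv => by
      refine mul_le_mul_of_nonneg_right ?_ hρ0.le
      by_cases huv : u = v
      · subst huv
        rw [dist_self_eq_zero u.2, if_pos rfl, if_pos hue]
        norm_num
      · rw [if_neg huv]
        by_cases hve : (v : α) ∈ e
        · rw [if_pos hve]
          have : (G.dist u v : ℝ) ≤ 1 := by exact_mod_cast dist_le_one he hue hve
          linarith
        · rw [if_neg hve]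
          obtain ⟨f, hf, hvf⟩ := hcov v (Finset.ne_of_mem_erase hv)
          have : (G.dist u v : ℝ) ≤ 2 := by
            exact_mod_cast dist_le_two he hf hue (hr e he) (hr f hf) hvf
          linarith
    have h3 := Finset.sum_le_sum h2
    have h4 : ∑ v ∈ Finset.univ.erase r,
        (2 - (if u = v then 1 else 0) - (if (v : α) ∈ e then 1 else 0)) * ρ
        = (2 * N - k : ℝ) * ρ := by
      rw [← Finset.sum_mul, Finset.sum_sub_distrib, Finset.sum_sub_distrib, Finset.sum_ite_eq,
        if_pos (Finset.mem_erase.2 ⟨hu, Finset.mem_univ _⟩), Finset.sum_boole,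
        hG.card_filter_mem_erase he (hr e he), Finset.sum_const, hWcard, Nat.cast_sub hk]
      simp only [nsmul_eq_mul, Nat.cast_one]
      ring
    nlinarith

theorem IsConnected.exists_mem_edge (hG : G.IsConnected) {u v : α} (hu : u ∈ G.vertexSet)
    (hv : v ∈ G.vertexSet) (huv : u ≠ v) : ∃ e ∈ G.edgeSet, u ∈ e := by
  obtain ⟨p, -⟩ := hG.2 u hu v hv
  cases p with
  | nil => exact absurd rfl huv
  | cons e he ha => exact ⟨e, he, ha⟩

/-- Lower bound for the distance spectral radius of a hypertree with a rooting in which every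
vertex that shares no edge with the root has a partner in another branch. -/
theorem IsHypertree.starRadius_le_of_rooting [Fintype G.vertexSet] {k N : ℕ} (hk : 1 ≤ k)
    (hN : 0 < N) (hcard : Fintype.card G.vertexSet = N + 1) (hunif : G.IsUniform k)
    (hG : G.IsHypertree) {r : G.vertexSet} {pe : G.vertexSet → G.edgeSet}
    {pv : G.edgeSet → G.vertexSet} (hpv : ∀ e : G.edgeSet, (pv e : α) ∈ (e : Set α))
    (hpe : ∀ v, v ≠ r → ∀ e, pe v = e ↔ (v : α) ∈ (e : Set α) ∧ v ≠ pv e)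
    (hroot : ∀ e : G.edgeSet, (r : α) ∈ (e : Set α) → pv e = r)
    (hbranch : ∀ v, v ≠ r → pv (pe v) ≠ r → ∃ u : G.vertexSet, u ≠ r ∧
      (∃ g ∈ G.edgeSet, (r : α) ∈ g ∧ (u : α) ∈ g) ∧ 3 ≤ G.dist u v) :
    starRadius N k ≤ G.distSpectralRadius ∧
      ((∃ v, v ≠ r ∧ pv (pe v) ≠ r) → starRadius N k < G.distSpectralRadius) := by
  classical
  set ρ := starRadius N k with hρ
  have hρ0 : 0 < ρ := starRadius_pos k hN
  have hρ2 : ρ ^ 2 = (2 * N - k) * ρ + N := starRadius_sq N k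
  have hN0 : (0 : ℝ) < N := Nat.cast_pos.2 hN
  have hWcard : (Finset.univ.erase r).card = N := by
    rw [Finset.card_erase_of_mem (Finset.mem_univ _), Finset.card_univ, hcard]; rfl
  have hshallow : ∀ v, v ≠ r → ∀ g (hg : g ∈ G.edgeSet), (r : α) ∈ g → (v : α) ∈ g →
      pv (pe v) = r := by
    intro v hv g hg hrg hvg
    have h1 := hroot ⟨g, hg⟩ hrg
    rw [(hpe v hv ⟨g, hg⟩).2 ⟨hvg, by rwa [h1]⟩, h1]
  have hφ : ∀ v, ∃ u : G.vertexSet, v ≠ r → pv (pe v) ≠ r →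
      u ≠ r ∧ pv (pe u) = r ∧ 3 ≤ G.dist u v := by
    intro v
    by_cases h : v ≠ r ∧ pv (pe v) ≠ r
    · obtain ⟨u, hu, ⟨g, hg, hrg, hug⟩, hd⟩ := hbranch v h.1 h.2
      exact ⟨u, fun _ _ => ⟨hu, hshallow u hu g hg hrg hug, hd⟩⟩
    · exact ⟨r, fun h1 h2 => absurd ⟨h1, h2⟩ h⟩
  choose φ hφ using hφ
  -- The fibre size is `k - 1`: an edge is the parent edge of all its vertices except `pv e`.
  have hquad := quadraticForm_rooted_lower_bound r (fun u v => (G.dist u v : ℝ)) pe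
    (fun v => pv (pe v)) φ (k := k - 1) (N := N) (a := N) (b := ρ) hN0.le hρ0.le hWcard
    (Nat.cast_nonneg _) ?_ (fun u v => by rw [G.dist_comm]) ?_ ?_ (fun v hv h => (hφ v hv h).1)
  rotate_left
  · intro v hv
    split_ifs with h
    · have : 2 ≤ G.dist r v := hG.1.two_le_dist r.2 v.2 (fun h' => hv (Subtype.ext h'.symm))
        fun e he hre hve => h (hshallow v hv e he hre hve)
      have : (2 : ℝ) ≤ G.dist r v := by exact_mod_cast this
      linarith
    · have := hG.1.one_le_dist r.2 v.2 (fun h' => hv (Subtype.ext h'.symm))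
      have : (1 : ℝ) ≤ G.dist r v := by exact_mod_cast this
      linarith
  · intro u v hu hv
    have b1 : ∀ p : Prop, ∀ _ : Decidable p, (0 : ℝ) ≤ if p then 1 else 0 := fun p _ => by
      split_ifs <;> norm_num
    have i1 := b1 (u = v) inferInstance
    have i2 := b1 (pe u = pe v) inferInstance
    have i3 := b1 (u = pv (pe v)) inferInstance
    have i4 := b1 (v = pv (pe u)) inferInstance
    -- A partner shares an edge with `r`, so it is not deep itself and the two `φ` indicators never
    -- fire together.
    by_cases h1 : pv (pe v) ≠ r ∧ u = φ v
    · obtain ⟨h2, h3, h4⟩ := hφ v hv h1.1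
      rw [← h1.2] at h3 h4
      have h5 : (3 : ℝ) ≤ G.dist u v := by exact_mod_cast h4
      have h6 : ¬(pv (pe u) ≠ r ∧ v = φ u) := fun h => h.1 h3
      rw [if_pos h1, if_neg h6]
      linarith
    by_cases h1' : pv (pe u) ≠ r ∧ v = φ u
    · obtain ⟨h2, h3, h4⟩ := hφ u hu h1'.1
      rw [← h1'.2, G.dist_comm] at h4
      have h5 : (3 : ℝ) ≤ G.dist u v := by exact_mod_cast h4
      rw [if_pos h1', if_neg h1]
      linarith
    rw [if_neg h1, if_neg h1']
    by_cases huv : u = v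
    · have : (0 : ℝ) ≤ G.dist u v := Nat.cast_nonneg _
      rw [if_pos huv, if_pos (congrArg pe huv)]
      linarith
    have huv' : (u : α) ≠ v := fun h => huv (Subtype.ext h)
    by_cases hadj : ∃ e ∈ G.edgeSet, (u : α) ∈ e ∧ (v : α) ∈ e
    · obtain ⟨e, he, hue, hve⟩ := hadj
      have h5 : (1 : ℝ) ≤ G.dist u v := by exact_mod_cast hG.1.one_le_dist u.2 v.2 huv'
      -- In a common edge, either one vertex is the parent of the other or both have it as parent
      -- edge.
      by_cases hu' : u = pv ⟨e, he⟩
      · have := (hpe v hv ⟨e, he⟩).2 ⟨hve, fun h => huv (hu'.trans h.symm)⟩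
        rw [← this] at hu'
        rw [if_pos hu']
        linarith
      · have hue' := (hpe u hu ⟨e, he⟩).2 ⟨hue, hu'⟩
        by_cases hv' : v = pv ⟨e, he⟩
        · rw [← hue'] at hv'
          rw [if_pos hv']
          linarith
        · rw [if_pos (hue'.trans ((hpe v hv ⟨e, he⟩).2 ⟨hve, hv'⟩).symm)]
          linarith
    · push Not at hadj
      have h5 : (2 : ℝ) ≤ G.dist u v := by
        exact_mod_cast hG.1.two_le_dist u.2 v.2 huv' hadj
      linarith
  · intro v hv
    rw [← hunif.card_filter_mem_erase (pe v).2 (hpv (pe v))]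
    congr 1
    ext u
    simp only [Finset.mem_filter, Finset.mem_erase, Finset.mem_univ, and_true]
    constructor
    · rintro ⟨h1, h2⟩
      have := (hpe u h1 (pe v)).1 h2.symm
      exact ⟨this.2, this.1⟩
    · rintro ⟨h1, h2⟩
      have hur : u ≠ r := by
        rintro rfl
        exact h1 (hroot _ h2).symm
      exact ⟨hur, ((hpe u hur (pe v)).2 ⟨h2, h1⟩).symm⟩
  have hray := Matrix.dotProduct_mulVec_le_sSup_hasEigenvalue G.distMatrix_isSymm
    (fun v => if v = r then (N : ℝ) else ρ)
  have hform : (fun v => if v = r then (N : ℝ) else ρ) ⬝ᵥ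
      G.distMatrix.mulVec (fun v => if v = r then (N : ℝ) else ρ) =
      ∑ u : G.vertexSet, ∑ v : G.vertexSet,
        (if u = r then (N : ℝ) else ρ) * (G.dist u v : ℝ) * (if v = r then (N : ℝ) else ρ) := by
    simp only [Matrix.mulVec, dotProduct, Finset.mul_sum, mul_assoc]
    rfl
  have hnorm : (fun v => if v = r then (N : ℝ) else ρ) ⬝ᵥ (fun v => if v = r then (N : ℝ) else ρ)
      = N ^ 2 + N * ρ ^ 2 := by
    simp only [dotProduct]
    rw [← Finset.add_sum_erase _ _ (Finset.mem_univ r), if_pos rfl,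
      Finset.sum_congr rfl (fun v hv => by rw [if_neg (Finset.ne_of_mem_erase hv)]),
      Finset.sum_const, hWcard, nsmul_eq_mul]
    ring
  rw [hform, hnorm] at hray
  change _ ≤ G.distSpectralRadius * _ at hray
  set D : ℝ := (((Finset.univ.erase r).filter fun v => pv (pe v) ≠ r).card : ℝ) with hD
  have hpos : (0 : ℝ) < N ^ 2 + N * ρ ^ 2 := by positivity
  have hmain : ρ * (N ^ 2 + N * ρ ^ 2) + 2 * N * ρ * D ≤
      G.distSpectralRadius * (N ^ 2 + N * ρ ^ 2) := by
    refine le_trans (le_of_eq ?_) (hquad.trans hray)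
    rw [Nat.cast_sub hk, Nat.cast_one]
    -- The quadratic equation for `ρ` makes the star part of the bound exactly `ρ` times the squared
    -- norm.
    linear_combination (N * ρ) * hρ2
  constructor
  · have : 0 ≤ 2 * N * ρ * D := by positivity
    exact le_of_mul_le_mul_right (by linarith) hpos
  · rintro ⟨v, hv, hv'⟩
    have hD0 : 0 < D := Nat.cast_pos.2 (Finset.card_pos.2 ⟨v, by simp [hv, hv']⟩)
    have : 0 < 2 * N * ρ * D := by positivity
    exact lt_of_mul_lt_mul_right (by linarith) hpos.le

/-- The number of non-root vertices of a uniform hypertree in terms of the number of edges. -/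
theorem IsUniform.card_edgeSet_mul_of_rooting [Fintype G.vertexSet] {k N : ℕ}
    (hcard : Fintype.card G.vertexSet = N + 1) (hunif : G.IsUniform k)
    {r : G.vertexSet} {pe : G.vertexSet → G.edgeSet}
    {pv : G.edgeSet → G.vertexSet} (hpv : ∀ e : G.edgeSet, (pv e : α) ∈ (e : Set α))
    (hpe : ∀ v, v ≠ r → ∀ e, pe v = e ↔ (v : α) ∈ (e : Set α) ∧ v ≠ pv e)
    (hroot : ∀ e : G.edgeSet, (r : α) ∈ (e : Set α) → pv e = r) [Fintype G.edgeSet] :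
    N = Fintype.card G.edgeSet * (k - 1) := by
  classical
  have hWcard : (Finset.univ.erase r).card = N := by
    rw [Finset.card_erase_of_mem (Finset.mem_univ _), Finset.card_univ, hcard]; rfl
  rw [← hWcard, Finset.card_eq_sum_card_fiberwise (f := pe) (t := Finset.univ)
    (fun _ _ => Finset.mem_univ _), Finset.sum_const_nat (m := k - 1), Finset.card_univ]
  intro e _
  rw [← hunif.card_filter_mem_erase e.2 (hpv e)]
  congr 1
  ext u
  simp only [Finset.mem_filter, Finset.mem_erase, Finset.mem_univ, and_true]
  constructor
  · rintro ⟨h1, h2⟩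
    exact ((hpe u h1 e).1 h2).symm
  · rintro ⟨h1, h2⟩
    have hur : u ≠ r := by
      rintro rfl
      exact h1 (hroot _ h2).symm
    exact ⟨hur, (hpe u hur e).2 ⟨h2, h1⟩⟩

theorem finite_edgeSet [Finite G.vertexSet] : Finite G.edgeSet :=
  ((Set.toFinite G.vertexSet).finite_subsets.subset G.subset_vertexSet_of_mem_edgeSet').to_subtype

end Hypergraph

/-! ### Hyperstars and their characterisation by a common vertex. -/

namespace Hypergraph

universe u

variable {α : Type u} {G : Hypergraph α}

theorem isConnected_of_forall_mem_edge {r : α} (hrV : r ∈ G.vertexSet)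
    (hr : ∀ e ∈ G.edgeSet, r ∈ e)
    (hcov : ∀ v ∈ G.vertexSet, v ≠ r → ∃ e ∈ G.edgeSet, v ∈ e) : G.IsConnected := by
  refine ⟨⟨r, hrV⟩, fun a ha b hb => ?_⟩
  by_cases hab : a = b
  · subst hab
    exact ⟨.nil ha, by simp [Walk.IsPath, Walk.support, Walk.edges]⟩
  have one : ∀ e ∈ G.edgeSet, a ∈ e → b ∈ e → ∃ p : G.Walk a b, p.IsPath := fun e he hae hbe =>
    ⟨.cons e he hae hbe hab (.nil hb), by simp [Walk.IsPath, Walk.support, Walk.edges, hab]⟩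
  by_cases har : a = r
  · obtain ⟨f, hf, hbf⟩ := hcov b hb (fun h => hab (har.trans h.symm))
    exact one f hf (har ▸ hr f hf) hbf
  obtain ⟨e, he, hae⟩ := hcov a ha har
  by_cases hbr : b = r
  · exact one e he hae (hbr ▸ hr e he)
  obtain ⟨f, hf, hbf⟩ := hcov b hb hbr
  by_cases hef : e = f
  · exact one e he hae (hef ▸ hbf)
  obtain ⟨p, hp, -⟩ := exists_isPath_length_two he hf hae (hr e he) (hr f hf) hbf har
    (Ne.symm hbr) hab hef
  exact ⟨p, hp⟩

/-- Two successive junctions of a cycle would both be `r`, although consecutive vertices differ. -/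
theorem not_isCycle_of_inter_subset {r : α}
    (h : ∀ e ∈ G.edgeSet, ∀ f ∈ G.edgeSet, e ≠ f → ∀ x ∈ e, x ∈ f → x = r)
    (a : α) (p : G.Walk a a) : ¬ p.IsCycle := by
  rintro ⟨hl, he, -⟩
  cases p with
  | nil => simp [Walk.length] at hl
  | @cons _ b _ e₁ he₁ ha hb hab p =>
    cases p with
    | nil => simp [Walk.length] at hl
    | @cons _ c _ e₂ he₂ hb' hc hbc p =>
      simp only [Walk.edges, List.nodup_cons, List.mem_cons, not_or] at he
      have hbr := h e₁ he₁ e₂ he₂ he.1.1 b hb hb'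
      cases p with
      | nil => exact hab ((h e₁ he₁ e₂ he₂ he.1.1 a ha hc).trans hbr.symm)
      | @cons _ d _ e₃ he₃ hc' hd hcd p =>
        simp only [Walk.edges, List.mem_cons, not_or] at he
        exact hbc (hbr.trans (h e₂ he₂ e₃ he₃ he.2.1.1 c hc hc').symm)

theorem none_mem_of_mem_edgeSet_hyperstar {n k : ℕ} :
    ∀ e ∈ (hyperstar n k).edgeSet, none ∈ e := by
  rintro _ ⟨i, rfl⟩
  exact Or.inl rfl

theorem exists_mem_edgeSet_hyperstar {n k : ℕ} :
    ∀ v, v ≠ none → ∃ e ∈ (hyperstar n k).edgeSet, v ∈ e := by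
  rintro (_ | ⟨i, j⟩) h
  · exact absurd rfl h
  · exact ⟨_, ⟨i, rfl⟩, Or.inr ⟨j, rfl⟩⟩

theorem isHypertree_hyperstar (n k : ℕ) : (hyperstar n k).IsHypertree := by
  refine ⟨isConnected_of_forall_mem_edge (r := none) (Set.mem_univ _)
    none_mem_of_mem_edgeSet_hyperstar fun v _ hv => exists_mem_edgeSet_hyperstar v hv,
    not_isCycle_of_inter_subset (r := none) ?_⟩
  rintro _ ⟨i, rfl⟩ _ ⟨j, rfl⟩ hij x hx hx'
  rcases hx with hx | ⟨y, rfl⟩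
  · exact hx
  · rcases hx' with hx' | ⟨z, hz⟩
    · exact hx'
    · simp only [Option.some.injEq, Prod.mk.injEq] at hz
      exact absurd (by rw [hz.1]) hij

theorem isUniform_hyperstar (n : ℕ) {k : ℕ} (hk : 1 ≤ k) : (hyperstar n k).IsUniform k := by
  rintro _ ⟨i, rfl⟩
  have hinj : Function.Injective fun j : Fin (k - 1) =>
      (some (i, j) : Option (Fin ((n - 1) / (k - 1)) × Fin (k - 1))) := fun a b h => by
    simpa using h
  change ({none} ∪ Set.range fun j => some (i, j) : Set (Option _)).ncard = k
  rw [Set.singleton_union, Set.ncard_insert_of_notMem (by simp), ← Set.image_univ,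
    Set.ncard_image_of_injective _ hinj, Set.ncard_univ, Nat.card_eq_fintype_card, Fintype.card_fin]
  omega

theorem card_vertexSet_hyperstar (n k : ℕ) :
    Fintype.card (hyperstar n k).vertexSet = (n - 1) / (k - 1) * (k - 1) + 1 := by
  let f : (hyperstar n k).vertexSet ≃ Option (Fin ((n - 1) / (k - 1)) × Fin (k - 1)) :=
    Equiv.Set.univ _
  rw [Fintype.card_congr f]
  simp

/-- A uniform hypertree with a vertex in all edges is isomorphic to a hyperstar. -/
theorem IsHypertree.isIsomorphic_hyperstar [Fintype G.vertexSet] {k N : ℕ} (hk : 2 ≤ k)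
    (hN : 0 < N) (hcard : Fintype.card G.vertexSet = N + 1) (hunif : G.IsUniform k)
    (hG : G.IsHypertree) (r : G.vertexSet) (hr : ∀ e ∈ G.edgeSet, (r : α) ∈ e) :
    G.IsIsomorphic (hyperstar (N + 1) k) := by
  classical
  have hne : ∀ e ∈ G.edgeSet, e.Nonempty := fun e he => ⟨r, hr e he⟩
  have : Finite G.edgeSet := finite_edgeSet
  have := Fintype.ofFinite G.edgeSet
  have hnt : Nontrivial G.vertexSet := Fintype.one_lt_card_iff_nontrivial.1 (by omega)
  obtain ⟨w, hw⟩ := exists_ne r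
  obtain ⟨e₀, he₀, -⟩ := hG.1.exists_mem_edge w.2 r.2 (fun h => hw (Subtype.ext h))
  obtain ⟨pe, pv, hpv, hpe, hroot⟩ := hG.exists_rooting hne r ⟨⟨e₀, he₀⟩⟩
  have hNE := hunif.card_edgeSet_mul_of_rooting hcard hpv hpe hroot
  have hpvr : ∀ e, pv e = r := fun e => hroot e (hr e e.2)
  have hpe' : ∀ v, v ≠ r → ∀ e, pe v = e ↔ (v : α) ∈ (e : Set α) := fun v hv e => by
    rw [hpe v hv e, hpvr e, and_iff_left hv]
  have hm : Fintype.card G.edgeSet = (N + 1 - 1) / (k - 1) := by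
    rw [Nat.add_sub_cancel, hNE, Nat.mul_div_cancel _ (by omega)]
  let ε : G.edgeSet ≃ Fin ((N + 1 - 1) / (k - 1)) := Fintype.equivFinOfCardEq hm
  have hfib : ∀ e : G.edgeSet, Fintype.card {v : {v // v ≠ r} // pe v = e} = k - 1 := by
    intro e
    rw [← hunif.card_filter_mem_erase e.2 (hr e e.2), Fintype.card_subtype,
      ← Finset.card_map (Function.Embedding.subtype _)]
    congr 1
    ext v
    simp only [Finset.mem_map, Finset.mem_filter, Finset.mem_univ, true_and,
      Function.Embedding.subtype_apply, Finset.mem_erase, and_true]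
    constructor
    · rintro ⟨⟨a, ha⟩, h, rfl⟩
      exact ⟨ha, (hpe' a ha e).1 h⟩
    · rintro ⟨ha, h⟩
      exact ⟨⟨v, ha⟩, (hpe' v ha e).2 h, rfl⟩
  -- Non-root vertices are sorted by their unique edge; every class has `k - 1` elements.
  let g : {v // v ≠ r} ≃ Fin ((N + 1 - 1) / (k - 1)) × Fin (k - 1) :=
    (Equiv.sigmaFiberEquiv fun v : {v // v ≠ r} => pe v).symm.trans
      ((Equiv.sigmaCongr ε fun e => Fintype.equivFinOfCardEq (hfib e)).trans
        (Equiv.sigmaEquivProd _ _))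
  have hg : ∀ v, (g v).1 = ε (pe v) := fun v => rfl
  let F : G.vertexSet ≃ Option (Fin ((N + 1 - 1) / (k - 1)) × Fin (k - 1)) :=
    (Equiv.optionSubtypeNe r).symm.trans (Equiv.optionCongr g)
  have hFr : F r = none := by simp [F]
  have hFv : ∀ v (hv : v ≠ r), F v = some (g ⟨v, hv⟩) := fun v hv => by
    simp [F, Equiv.optionSubtypeNe_symm_of_ne hv]
  have himage : ∀ e : G.edgeSet, F '' {v | (v : α) ∈ (e : Set α)} =
      {none} ∪ Set.range fun j => some (ε e, j) := by
    intro e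
    ext y
    obtain ⟨v, rfl⟩ := F.surjective y
    rw [F.injective.mem_set_image]
    by_cases hv : v = r
    · subst hv
      simp [hFr, hr e e.2]
    · rw [hFv v hv, Set.mem_ofPred_eq, ← hpe' v hv e]
      constructor
      · rintro rfl
        exact Or.inr ⟨(g ⟨v, hv⟩).2, by rw [← hg ⟨v, hv⟩]⟩
      · rintro (h | ⟨j, hj⟩)
        · exact absurd h (by simp)
        · refine ε.injective ?_
          rw [← hg ⟨v, hv⟩, ← Option.some_injective _ hj]
  refine ⟨F.trans (Equiv.Set.univ _).symm, fun s => ?_⟩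
  have hval : Subtype.val '' ((F.trans (Equiv.Set.univ _).symm : G.vertexSet ≃
      (hyperstar (N + 1) k).vertexSet) '' s) = F '' s := by
    rw [Set.image_image]
    rfl
  rw [hval]
  constructor
  · intro hs
    refine ⟨ε ⟨_, hs⟩, ?_⟩
    change ({none} ∪ Set.range fun j => some (ε ⟨_, hs⟩, j)) = F '' s
    rw [← himage ⟨_, hs⟩]
    congr 1
    ext v
    simp
  · rintro ⟨i, hi⟩
    change {none} ∪ (Set.range fun j => some (i, j)) = F '' s at hi
    rw [← ε.apply_symm_apply i, ← himage (ε.symm i)] at hi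
    rw [← F.injective.image_injective hi]
    convert (ε.symm i).2
    ext x
    simp only [Set.mem_image, Set.mem_ofPred_eq, Subtype.exists, exists_and_left, exists_prop,
      exists_eq_right_right]
    exact ⟨fun h => h.1, fun h => ⟨h, G.subset_vertexSet_of_mem_edgeSet' (ε.symm i).2 h⟩⟩

/-- A hypergraph isomorphic to a hyperstar has a vertex in all edges. -/
theorem IsIsomorphic.exists_forall_mem_edge {n k : ℕ} (h : G.IsIsomorphic (hyperstar n k)) :
    ∃ r : G.vertexSet, ∀ e ∈ G.edgeSet, (r : α) ∈ e := by
  obtain ⟨f, hf⟩ := h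
  refine ⟨f.symm ⟨none, Set.mem_univ _⟩, fun e he => ?_⟩
  have hs : Subtype.val '' {v : G.vertexSet | (v : α) ∈ e} = e := by
    ext x
    simp only [Set.mem_image, Set.mem_ofPred_eq, Subtype.exists, exists_and_left, exists_prop,
      exists_eq_right_right]
    exact ⟨fun h => h.1, fun h => ⟨h, G.subset_vertexSet_of_mem_edgeSet' he h⟩⟩
  obtain ⟨y, ⟨v, hv, rfl⟩, hy⟩ :=
    none_mem_of_mem_edgeSet_hyperstar _ ((hf _).1 (by rw [hs]; exact he))
  have : f.symm ⟨none, Set.mem_univ _⟩ = v := f.symm_apply_eq.2 (Subtype.ext hy.symm)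
  rwa [this]

/-! ### The extremal dichotomy and the conclusion. -/

/-- The distance spectral radius of a uniform hypertree with a vertex in all edges. -/
theorem IsHypertree.distSpectralRadius_eq_starRadius [Fintype G.vertexSet] {k N : ℕ} (hk : 2 ≤ k)
    (hN : 0 < N) (hcard : Fintype.card G.vertexSet = N + 1) (hunif : G.IsUniform k)
    (hG : G.IsHypertree) (r : G.vertexSet) (hr : ∀ e ∈ G.edgeSet, (r : α) ∈ e) :
    G.distSpectralRadius = starRadius N k := by
  have hcov : ∀ v : G.vertexSet, v ≠ r → ∃ e ∈ G.edgeSet, (v : α) ∈ e := fun v hv =>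
    hG.1.exists_mem_edge v.2 r.2 (fun h => hv (Subtype.ext h))
  refine le_antisymm
    (distSpectralRadius_le_starRadius (by omega) hN hcard hunif r hr hcov) ?_
  have hnt : Nontrivial G.vertexSet := Fintype.one_lt_card_iff_nontrivial.1 (by omega)
  obtain ⟨w, hw⟩ := exists_ne r
  obtain ⟨e₀, he₀, -⟩ := hcov w hw
  obtain ⟨pe, pv, hpv, hpe, hroot⟩ := hG.exists_rooting (fun e he => ⟨r, hr e he⟩) r ⟨⟨e₀, he₀⟩⟩
  exact (hG.starRadius_le_of_rooting (by omega) hN hcard hunif hpv hpe hroot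
    fun v _ h => absurd (hroot _ (hr _ (pe v).2)) h).1

/-- A uniform hypertree without a vertex in all edges has larger distance spectral radius than the
hyperstar of the same order. -/
theorem IsHypertree.starRadius_lt_distSpectralRadius [Fintype G.vertexSet] {k N : ℕ} (hk : 2 ≤ k)
    (hN : 0 < N) (hcard : Fintype.card G.vertexSet = N + 1) (hunif : G.IsUniform k)
    (hG : G.IsHypertree) (hr : ∀ r : G.vertexSet, ∃ e ∈ G.edgeSet, (r : α) ∉ e) :
    starRadius N k < G.distSpectralRadius := by
  have hne : ∀ e ∈ G.edgeSet, ∀ x, ∃ y ∈ e, y ≠ x := fun e he x =>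
    Set.exists_ne_of_one_lt_ncard (by rw [hunif e he]; omega) x
  obtain ⟨r₀, hr₀⟩ := hG.1.1
  have hrooting : ∀ r : G.vertexSet, _ := fun r =>
    hG.exists_rooting (fun e he => (hne e he r₀).imp fun _ h => h.1) r
      (Set.Nonempty.to_subtype ((hr ⟨r₀, hr₀⟩).imp fun e h => h.1))
  -- In an edge `e` missing `r`, any vertex other than `pv e` has parent `pv e`, which is not `r`.
  have hdeep : ∀ (r : G.vertexSet) (pe : G.vertexSet → G.edgeSet) (pv : G.edgeSet → G.vertexSet),
      (∀ e : G.edgeSet, (pv e : α) ∈ (e : Set α)) →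
      (∀ v, v ≠ r → ∀ e, pe v = e ↔ (v : α) ∈ (e : Set α) ∧ v ≠ pv e) →
      (∀ e : G.edgeSet, (r : α) ∈ (e : Set α) → pv e = r) → ∃ v, v ≠ r ∧ pv (pe v) ≠ r := by
    intro r pe pv hpv hpe hroot
    obtain ⟨e, he, hre⟩ := hr r
    obtain ⟨y, hy, hy'⟩ := hne e he (pv ⟨e, he⟩)
    have hyr : (⟨y, G.subset_vertexSet_of_mem_edgeSet' he hy⟩ : G.vertexSet) ≠ r := by
      rintro rfl
      exact hre hy
    refine ⟨_, hyr, fun h => hre ?_⟩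
    rw [(hpe _ hyr ⟨e, he⟩).2 ⟨hy, fun h => hy' (congrArg Subtype.val h)⟩] at h
    exact h ▸ hpv ⟨e, he⟩
  obtain ⟨pe₀, pv₀, hpv₀, hpe₀, hroot₀⟩ := hrooting ⟨r₀, hr₀⟩
  obtain ⟨v₀, hv₀, hr⟩ := hdeep _ _ _ hpv₀ hpe₀ hroot₀
  -- Re-root at the parent of a deep vertex: it lies in `pe₀ v₀` and in its own parent edge, hence
  -- in two edges.
  set r := pv₀ (pe₀ v₀) with hrdef
  have hedges : pe₀ r ≠ pe₀ v₀ := fun h => ((hpe₀ r hr _).1 h).2 rfl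
  have hre : (r : α) ∈ (pe₀ r : Set α) := ((hpe₀ r hr _).1 rfl).1
  obtain ⟨pe, pv, hpv, hpe, hroot⟩ := hrooting r
  refine (hG.starRadius_le_of_rooting (by omega) hN hcard hunif hpv hpe hroot ?_).2
    (hdeep _ _ _ hpv hpe hroot)
  intro v hv hv'
  refine hG.exists_three_le_dist hk hunif (pe₀ r).2 (pe₀ v₀).2
    (fun h => hedges (Subtype.ext h)) hre (hpv₀ _) hv fun g hg hrg hvg => hv' ?_
  have h1 := hroot ⟨g, hg⟩ hrg
  rw [(hpe v hv ⟨g, hg⟩).2 ⟨hvg, by rwa [h1]⟩, h1]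

end Hypergraph

/-- `hyperstar` uses truncated division, so its having `n` vertices encodes that `k - 1` divides `n
- 1`. -/
theorem theorem4p4 {α : Type*} (n k : ℕ) (hk : 2 ≤ k) (hkn : k ≤ n)
    (T : Hypergraph α) [Fintype T.vertexSet] (hn : Fintype.card T.vertexSet = n)
    (hT : T.IsUniform k) (hT' : T.IsHypertree) :
    ((Hypergraph.hyperstar n k).IsUniform k ∧ (Hypergraph.hyperstar n k).IsHypertree ∧
      Fintype.card (Hypergraph.hyperstar n k).vertexSet = n) ∧
    (Hypergraph.hyperstar n k).distSpectralRadius ≤ T.distSpectralRadius ∧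
    (T.distSpectralRadius = (Hypergraph.hyperstar n k).distSpectralRadius ↔
      T.IsIsomorphic (Hypergraph.hyperstar n k)) := by
  obtain ⟨N, rfl⟩ : ∃ N, n = N + 1 := ⟨n - 1, by omega⟩
  have hN : 0 < N := by omega
  have hSu := Hypergraph.isUniform_hyperstar (N + 1) (k := k) (by omega)
  have hSt := Hypergraph.isHypertree_hyperstar (N + 1) k
  have hScard : Fintype.card (Hypergraph.hyperstar (N + 1) k).vertexSet = N + 1 := by
    have : Finite T.edgeSet := Hypergraph.finite_edgeSet
    have := Fintype.ofFinite T.edgeSet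
    obtain ⟨r, hr⟩ := hT'.1.1
    have hnt : Nontrivial T.vertexSet := Fintype.one_lt_card_iff_nontrivial.1 (by omega)
    obtain ⟨w, hw⟩ := exists_ne (⟨r, hr⟩ : T.vertexSet)
    obtain ⟨e₀, he₀, -⟩ := hT'.1.exists_mem_edge w.2 hr (fun h => hw (Subtype.ext h))
    obtain ⟨pe, pv, hpv, hpe, hroot⟩ := hT'.exists_rooting (fun e he => by
      rw [Set.nonempty_iff_ne_empty]
      rintro rfl
      have := hT _ he
      simp at this
      omega) ⟨r, hr⟩ ⟨⟨e₀, he₀⟩⟩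
    rw [Hypergraph.card_vertexSet_hyperstar, Nat.add_sub_cancel,
      Nat.div_mul_cancel ⟨_, (hT.card_edgeSet_mul_of_rooting hn hpv hpe hroot).trans (mul_comm _ _)⟩]
  have hSρ := hSt.distSpectralRadius_eq_starRadius hk hN hScard hSu ⟨none, Set.mem_univ _⟩
    Hypergraph.none_mem_of_mem_edgeSet_hyperstar
  refine ⟨⟨hSu, hSt, hScard⟩, ?_⟩
  rw [hSρ]
  by_cases h : ∃ r : T.vertexSet, ∀ e ∈ T.edgeSet, (r : α) ∈ e
  · obtain ⟨r, hr⟩ := h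
    have hTρ := hT'.distSpectralRadius_eq_starRadius hk hN hn hT r hr
    exact ⟨hTρ.ge, fun _ => hT'.isIsomorphic_hyperstar hk hN hn hT r hr, fun _ => hTρ⟩
  · have hlt := hT'.starRadius_lt_distSpectralRadius hk hN hn hT (by push Not at h; exact h)
    exact ⟨hlt.le, fun h' => absurd h' hlt.ne', fun h' => absurd h'.exists_forall_mem_edge h⟩
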